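/- Let $\mathcal F=(F_1,F_2)$ be a pair of finite (possibly empty) sets of positive integers, let $k_i$ be the number of elements of $F_i$, and put $k=k_1+k_2$. For real $\alpha$ and $n\in\mathbb N=\{0,1,2,\dots\}$ let $$L_n^{\alpha}(x)=\sum_{j=0}^{n}\frac{(-x)^j}{j!}\binom{n+\alpha}{n-j}$$ be the Laguerre polynomials, where $\binom{a}{m}=a(a-1)\cdots(a-m+1)/m!$, and let $\Omega_{\mathcal F}^{\alpha}(x)$ be the determinant of the $k\times k$ matrix (columns indexed by $j=0,\dots,k-1$) whose first $k_1$ rows are $$\bigl(L_f^{\alpha}(x),\ (L_f^{\alpha})'(x),\ \dots,\ (L_f^{\alpha})^{(k-1)}(x)\bigr),\qquad f\in F_1,$$ and whose last $k_2$ rows are $$\bigl(L_f^{\alpha}(-x),\ L_f^{\alpha+1}(-x),\ \dots,\ L_f^{\alpha+k-1}(-x)\bigr),\qquad f\in F_2,$$ the elements of each set being taken in increasing order (for $k=0$, $\Omega_{\mathcal F}^{\alpha}=1$). For a real number $c\notin\{0,-1,-2,\dots\}$ put $\hat c=\max\{-[c],0\}$, where $[c]=\max\{s\in\mathbb Z: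 s\le c\}$. One says that $c$ and $\mathcal F$ are admissible if $$\frac{\prod_{f\in F_1}(n-f)\,\prod_{f\in F_2}(n+c+f)}{(n+c)_{\hat c}}\ \ge\ 0\qquad\text{for all } n\in\mathbb N,$$ where $(a)_0=1$ and $(a)_j=a(a+1)\cdots(a+j-1)$ for $j\ge1$. **Theorem.** Let $\alpha$ be a real number with $\alpha\ne-1,-2,\dots$. If $\alpha+k>-1$ and $\Omega_{\mathcal F}^{\alpha}(x)\ne0$ for all $x\ge0$, then $\alpha+1$ and $\mathcal F$ are admissible. -/

import Mathlib

open Polynomial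

noncomputable section

namespace ExceptionalLaguerre

/-- The Laguerre polynomial
`L_n^α(x) = ∑_{j=0}^n (-x)^j / j! * binom(n+α, n-j)`, for real `α`, where `binom(a, m)` is the
generalized binomial coefficient `a (a-1) ⋯ (a-m+1) / m!`. -/
def laguerre (n : ℕ) (α : ℝ) : ℝ[X] :=
  ∑ j ∈ Finset.range (n + 1),
    C (Ring.choose ((n : ℝ) + α) (n - j) / (j.factorial : ℝ)) * (-X) ^ j

/-- The square matrix of size `k = k₁ + k₂`, with columns `j = 0, …, k - 1`, whose first `k₁` rows
are `(L_f^α)^{(j)}(x)` for `f ∈ F₁` and whose last `k₂` rows are `L_f^{α+j}(-x)` for `f ∈ F₂`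
(the elements of each set being taken in increasing order). -/
def omegaMatrix (F₁ F₂ : Finset ℕ) (α : ℝ) :
    Matrix (Fin (F₁.card + F₂.card)) (Fin (F₁.card + F₂.card)) ℝ[X] :=
  Matrix.of fun i j =>
    Fin.addCases
      (fun a : Fin F₁.card => derivative^[(j : ℕ)] (laguerre (F₁.orderEmbOfFin rfl a) α))
      (fun b : Fin F₂.card =>
        (laguerre (F₂.orderEmbOfFin rfl b) (α + ((j : ℕ) : ℝ))).comp (-X))
      i

/-- The polynomial `Ω_F^α`, for `F = (F₁, F₂)`. -/
def omega (F₁ F₂ : Finset ℕ) (α : ℝ) : ℝ[X] :=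
  (omegaMatrix F₁ F₂ α).det

/-- `ĉ = max {-[c], 0}`, where `[c]` is the largest integer not exceeding `c`. -/
def hat (c : ℝ) : ℕ :=
  (max (-⌊c⌋) 0).toNat

/-- Admissibility of a real number `c` (not one of `0, -1, -2, …`) and a pair `F = (F₁, F₂)` of
finite sets of positive integers; `(a)_j` is the Pochhammer symbol `a (a+1) ⋯ (a+j-1)`. -/
def Admissible (c : ℝ) (F₁ F₂ : Finset ℕ) : Prop :=
  ∀ n : ℕ,
    0 ≤ ((∏ f ∈ F₁, ((n : ℝ) - (f : ℝ))) * ∏ f ∈ F₂, ((n : ℝ) + c + (f : ℝ))) /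
      (ascPochhammer ℝ (hat c)).eval ((n : ℝ) + c)

end ExceptionalLaguerre

end

/-! Up to a factor `e^{-k₂ x}`, `Ω` is the Wronskian of `k` eigenfunctions of `x D² + (α + 1 - x)
D`: `L_f^α(x)` with eigenvalue `-f`, and `e^x L_f^α(-x)` with eigenvalue `f + α + 1`. Append `L_n^α`
and let `s` be the quotient of the two consecutive Wronskians. By Crum's theorem `s` arises from
`L_n^α` by `k` Darboux steps, and each step preserves squares up to an eigenvalue difference and an
exact derivative. Hence (`exists_pow_mul_sq_eq_omega`) `x^k s² = B (L_n^α)² + x^{-α} e^x (x^{α+1}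
e^{-x} b₁)'`, with `B` the numerator in the admissibility condition. Taking `ĉ` steps with the seed
`e^x` instead gives (`exists_pow_mul_laguerre_sq_eq`) the same relation for `x^ĉ (L_n^{α+ĉ})²`, with
the denominator `A` in place of `B`.

If `B / A < 0`, put `t = -B / A > 0`. The terms in `(L_n^α)²` cancel, and the nonnegative function
`x^k s² + t x^ĉ (L_n^{α+ĉ})²` becomes an exact weighted derivative of a rational `b`. Seeds do not
vanish at `0`, so `b` has no pole there, and it is divisible by `x^N` with `N = min k ĉ`; this moves
the weight exponent to `α + 1 + N > 0`. On `(0, ∞)` a pole would become deeper under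
differentiation, so there is none. The weighted function thus tends to `0` at both ends while being
monotone, so its derivative vanishes and `L_n^{α+ĉ} = 0`, which is absurd. Working with rational
functions avoids integrals that diverge for `α ≤ -1`. -/

/-- The twisted derivation `r ↦ r' + ε r`. -/
def twist {A : Type*} [CommRing A] [Algebra ℝ A] (d : Derivation ℝ A A) (ε r : A) : A :=
  d r + ε * r

/-! ### Twisted derivations and Wronskians over a differential ring. -/

section Twist

variable {A : Type*} [CommRing A] [Algebra ℝ A] (d : Derivation ℝ A A)

theorem twist_add (ε r s : A) : twist d ε (r + s) = twist d ε r + twist d ε s := by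
  simp only [twist, map_add]; ring

theorem twist_mul (ε r s : A) : twist d ε (r * s) = d r * s + r * twist d ε s := by
  simp only [twist, Derivation.leibniz, smul_eq_mul]; ring

theorem twist_zero_right (ε : A) : twist d ε 0 = 0 := by
  simp [twist]

theorem twist_sum {ι : Type*} (ε : A) (s : Finset ι) (f : ι → A) :
    twist d ε (∑ i ∈ s, f i) = ∑ i ∈ s, twist d ε (f i) := by
  simp only [twist, map_sum, Finset.mul_sum, Finset.sum_add_distrib]

theorem twist_iterate_zero_right (ε : A) (n : ℕ) : (twist d ε)^[n] 0 = 0 := by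
  induction n with
  | zero => rfl
  | succ n ih => rw [Function.iterate_succ_apply', ih, twist_zero_right]

theorem twist_iterate_add (ε r s : A) (n : ℕ) :
    (twist d ε)^[n] (r + s) = (twist d ε)^[n] r + (twist d ε)^[n] s := by
  induction n with
  | zero => rfl
  | succ n ih => simp only [Function.iterate_succ_apply', ih, twist_add]

/-- A Leibniz expansion whose coefficients do not depend on the twist. -/
theorem exists_twist_iterate_mul (u : A) (j : ℕ) :
    ∃ c : ℕ → A, ∀ ε r : A,
      (twist d ε)^[j] (u * r) = ∑ l ∈ Finset.range (j + 1), c l * (twist d ε)^[l] r := by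
  induction j with
  | zero => exact ⟨fun _ => u, fun ε r => by simp⟩
  | succ j ih =>
    obtain ⟨c, hc⟩ := ih
    refine ⟨fun l => (if l ≤ j then d (c l) else 0) + (if l = 0 then 0 else c (l - 1)),
      fun ε r => ?_⟩
    rw [Function.iterate_succ_apply', hc, twist_sum]
    simp only [twist_mul, add_mul, Finset.sum_add_distrib]
    congr 1
    · rw [Finset.sum_range_succ _ (j + 1)]
      simp only [show ¬ (j + 1 ≤ j) by omega, if_false, zero_mul, add_zero]
      refine Finset.sum_congr rfl fun l hl => ?_
      rw [if_pos (by simpa [Nat.lt_succ_iff] using hl)]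
    · rw [Finset.sum_range_succ' _ (j + 1)]
      simp [Function.iterate_succ_apply']

/-- The Wronskian determinant of the first `n` terms of a sequence, each row being differentiated
by its own twisted derivation. -/
def twistedWronskian (r ε : ℕ → A) (n : ℕ) : A :=
  (Matrix.of fun i j : Fin n => (twist d (ε i))^[(j : ℕ)] (r i)).det

/-- One step of Crum's factorization: column operations turn every later column into iterated
derivatives of the Darboux transforms, and `u`, the logarithmic derivative of the first function,
makes the first transform zero. -/
theorem twistedWronskian_succ (r ε : ℕ → A) (u : A) (hu : twist d (ε 0) (r 0) = u * r 0)
    (n : ℕ) :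
    twistedWronskian d r ε (n + 1) = r 0 *
      twistedWronskian d (fun i => twist d (ε (i + 1)) (r (i + 1)) - u * r (i + 1))
        (fun i => ε (i + 1)) n := by
  choose c hc using exists_twist_iterate_mul d u
  set M : Matrix (Fin (n + 1)) (Fin (n + 1)) A :=
    Matrix.of fun i j => (twist d (ε i))^[(j : ℕ)] (r i) with hM
  set s : ℕ → A := fun i => twist d (ε i) (r i) - u * r i with hs
  set N : Matrix (Fin (n + 1)) (Fin (n + 1)) A :=
    Matrix.of fun i j => Fin.cases (r i) (fun l : Fin n => (twist d (ε i))^[(l : ℕ)] (s i)) j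
    with hN
  -- The column operations subtract the Leibniz expansion of the `j`-th derivative of `u * r i` from
  -- column `j + 1`. One matrix serves all rows because the coefficients `c j` are independent of
  -- the twist.
  set L : Matrix (Fin (n + 1)) (Fin (n + 1)) A :=
    Matrix.of fun l j => Fin.cases (if l = 0 then 1 else 0)
      (fun j : Fin n => (if l = j.succ then 1 else 0) - (if l < j.succ then c j l else 0)) j
    with hL
  have hNML : N = M * L := by
    ext i j
    rw [Matrix.mul_apply]
    induction j using Fin.cases with
    | zero => simp [hN, hM, hL]
    | succ j =>
      simp only [hN, hM, hL, Matrix.of_apply, Fin.cases_succ, mul_sub, Finset.sum_sub_distrib,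
        mul_ite, mul_one, mul_zero, Finset.sum_ite_eq', Finset.mem_univ, if_true]
      have h1 : (twist d (ε i))^[(j : ℕ)] (s i) + (twist d (ε i))^[(j : ℕ)] (u * r i)
          = (twist d (ε i))^[((j.succ : Fin (n + 1)) : ℕ)] (r i) := by
        rw [← twist_iterate_add, hs, Fin.val_succ, Function.iterate_succ_apply]
        congr 1
        ring
      have h2 : ∑ l : Fin (n + 1), (if l < j.succ then
          (twist d (ε i))^[(l : ℕ)] (r i) * c j l else 0) =
          ∑ l ∈ Finset.range (j + 1), c j l * (twist d (ε i))^[l] (r i) := by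
        have := Fin.sum_univ_eq_sum_range (fun l => if l < (j : ℕ) + 1 then
          (twist d (ε i))^[l] (r i) * c j l else 0) (n + 1)
        simp only [Fin.lt_def, Fin.val_succ]
        rw [this, ← Finset.sum_filter]
        refine Finset.sum_congr ?_ fun l _ => mul_comm _ _
        ext l
        simp only [Finset.mem_filter, Finset.mem_range]
        omega
      rw [h2, ← hc, ← h1]
      ring
  have hLdet : L.det = 1 := by
    rw [Matrix.det_of_isUpperTriangular]
    · refine Finset.prod_eq_one fun i _ => ?_
      induction i using Fin.cases <;> simp [hL]
    · intro i j hij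
      induction j using Fin.cases with
      | zero =>
        have : i ≠ 0 := by rintro rfl; simp at hij
        simp [hL, this]
      | succ j =>
        have h3 : j.succ < i := hij
        simp [hL, h3.ne', h3.not_gt]
  have hdet : M.det = N.det := by rw [hNML, Matrix.det_mul, hLdet, mul_one]
  have hs0 : s 0 = 0 := by simp [hs, hu]
  change M.det = _
  rw [hdet, Matrix.det_succ_row_zero, Fin.sum_univ_succ]
  simp only [hN, Matrix.of_apply, Fin.cases_succ, Fin.cases_zero, Fin.val_zero, hs0,
    twist_iterate_zero_right, mul_zero, zero_mul, Finset.sum_const_zero, add_zero, pow_zero,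
    one_mul]
  congr 1

theorem map_twist_iterate {B : Type*} [CommRing B] [Algebra ℝ B] (d' : Derivation ℝ B B)
    (φ : A →+* B) (h : ∀ a, φ (d a) = d' (φ a)) (ε r : A) (n : ℕ) :
    φ ((twist d ε)^[n] r) = (twist d' (φ ε))^[n] (φ r) := by
  induction n with
  | zero => rfl
  | succ n ih => simp only [Function.iterate_succ_apply', ← ih, twist, map_add, map_mul, h]

theorem map_twistedWronskian {B : Type*} [CommRing B] [Algebra ℝ B] (d' : Derivation ℝ B B)
    (φ : A →+* B) (h : ∀ a, φ (d a) = d' (φ a)) (r ε : ℕ → A) (n : ℕ) :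
    φ (twistedWronskian d r ε n) = twistedWronskian d' (fun i => φ (r i)) (fun i => φ (ε i)) n := by
  unfold twistedWronskian
  rw [RingHom.map_det]
  congr 1
  ext i j
  simp [map_twist_iterate d d' φ h]

end Twist

/-! ### Darboux steps for Laguerre type operators. -/

section Darboux

variable {K : Type*} [Field K] [Algebra ℝ K] (d : Derivation ℝ K K)

/-- `x^{1-a} e^x (x^a e^{-x} b)'`, the derivative of `b` in the presence of a Laguerre weight. -/
def weightedDeriv (x : K) (a : ℝ) (b : K) : K :=
  x * d b + (algebraMap ℝ K a - x) * b

/-- The Laguerre type operator `x D² + (a - x) D + V`, where `D r = r' + ε r`. -/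
def laguerreOp (x : K) (a : ℝ) (V ε r : K) : K :=
  x * twist d ε (twist d ε r) + (algebraMap ℝ K a - x) * twist d ε r + V * r

theorem weightedDeriv_add (x : K) (a : ℝ) (b c : K) :
    weightedDeriv d x a (b + c) = weightedDeriv d x a b + weightedDeriv d x a c := by
  simp only [weightedDeriv, map_add]; ring

theorem weightedDeriv_algebraMap_mul (x : K) (a t : ℝ) (b : K) :
    weightedDeriv d x a (algebraMap ℝ K t * b) = algebraMap ℝ K t * weightedDeriv d x a b := by
  simp only [weightedDeriv, Derivation.leibniz, Derivation.map_algebraMap, smul_eq_mul]; ring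

/-- The factor `x ^ n` is absorbed into the weight `x^a e^{-x}`. -/
theorem weightedDeriv_pow_mul {x : K} (hx : d x = 1) (a : ℝ) (n : ℕ) (b : K) :
    weightedDeriv d x a (x ^ n * b) = x ^ n * weightedDeriv d x (a + n) b := by
  induction n generalizing a with
  | zero => simp
  | succ n ih =>
    have h : ∀ (a : ℝ) (b : K),
        weightedDeriv d x a (x * b) = x * weightedDeriv d x (a + 1) b := by
      intro a b
      simp only [weightedDeriv, Derivation.leibniz, smul_eq_mul, hx, map_add, map_one]; ring
    rw [pow_succ', mul_assoc, h, ih, mul_assoc, Nat.cast_succ, add_assoc, add_comm (1 : ℝ)]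

/-- The first order equation satisfied by the Darboux transform of an eigenfunction. -/
theorem mul_twist_darboux {x : K} (a : ℝ) {V u l m ε r : K}
    (hu : x * (d u + u * u) + (algebraMap ℝ K a - x) * u + V = l)
    (hr : laguerreOp d x a V ε r = m * r) :
    x * twist d ε (twist d ε r - u * r) =
      (m - l) * r - (algebraMap ℝ K a - x + x * u) * (twist d ε r - u * r) := by
  simp only [laguerreOp] at hr
  have h : twist d ε (twist d ε r - u * r) =
      twist d ε (twist d ε r) - (d u * r + u * twist d ε r) := by
    rw [← twist_mul]; simp only [twist, map_sub, map_add]; ring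
  rw [h]
  linear_combination hr - r * hu

/-- The Darboux transform of an eigenfunction is an eigenfunction of the transformed operator. -/
theorem laguerreOp_darboux {x : K} (hx : d x = 1) (a : ℝ) {V u l m ε r : K}
    (hu : x * (d u + u * u) + (algebraMap ℝ K a - x) * u + V = l) (hm : d (m - l) = 0)
    (hr : laguerreOp d x a V ε r = m * r) :
    laguerreOp d x (a + 1) (l + x * d u + u - 1 - (algebraMap ℝ K a - x) * u - x * (u * u)) ε
      (twist d ε r - u * r) = m * (twist d ε r - u * r) := by
  have h1 := mul_twist_darboux d a hu hr
  set s := twist d ε r - u * r with hs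
  have h2 := congrArg (twist d ε) h1
  rw [twist_mul, hx] at h2
  have h3 : twist d ε ((m - l) * r - (algebraMap ℝ K a - x + x * u) * s) =
      (m - l) * twist d ε r - ((-1 + u + x * d u) * s +
        (algebraMap ℝ K a - x + x * u) * twist d ε s) := by
    have h4 : twist d ε ((m - l) * r) = d (m - l) * r + (m - l) * twist d ε r := twist_mul ..
    have h5 : twist d ε ((algebraMap ℝ K a - x + x * u) * s) =
      d (algebraMap ℝ K a - x + x * u) * s + (algebraMap ℝ K a - x + x * u) * twist d ε s :=
      twist_mul ..
    have h6 : ∀ p q : K, twist d ε (p - q) = twist d ε p - twist d ε q := by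
      intro p q; simp only [twist, map_sub]; ring
    rw [h6, h4, h5, hm]
    simp only [map_add, map_sub, Derivation.map_algebraMap, Derivation.leibniz, smul_eq_mul, hx]
    ring
  rw [h3] at h2
  simp only [laguerreOp, map_add, map_one]
  linear_combination h2 - u * h1 - (m - l) * hs

/-- The norm identity of a single Darboux step. -/
theorem mul_sq_darboux {x : K} (a : ℝ) {V u l m y : K}
    (hu : x * (d u + u * u) + (algebraMap ℝ K a - x) * u + V = l)
    (hy : laguerreOp d x a V 0 y = m * y) :
    x * (twist d 0 y - u * y) ^ 2 =
      (l - m) * y ^ 2 + weightedDeriv d x a (y * (twist d 0 y - u * y)) := by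
  have h1 := mul_twist_darboux d a hu hy
  set s := twist d 0 y - u * y with hs
  have h2 : d y = s + u * y := by rw [hs]; simp [twist]
  have h3 : twist d 0 s = d s := by simp [twist]
  rw [h3] at h1
  simp only [weightedDeriv, Derivation.leibniz, smul_eq_mul, h2]
  linear_combination -y * h1

/-- A subalgebra stable under `d` in which, up to units, every element is a power of `x`. -/
structure IsRegularAt (O : Subalgebra ℝ K) (x : K) : Prop where
  deriv_self : d x = 1
  self_mem : x ∈ O
  inv_notMem : x⁻¹ ∉ O
  deriv_mem : ∀ r ∈ O, d r ∈ O
  exists_eq_pow_mul : ∀ r ∈ O, r ≠ 0 → ∃ (q : ℕ) (v : K), v ∈ O ∧ v⁻¹ ∈ O ∧ r = x ^ q * v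

/-! ### Local analysis at the singular point, and iteration of the norm identity. -/

namespace IsRegularAt

variable {d} {O : Subalgebra ℝ K} {x : K}

theorem ne_zero (h : IsRegularAt d O x) : x ≠ 0 := by
  rintro rfl
  simpa using h.deriv_self

theorem twist_mem (h : IsRegularAt d O x) {ε r : K} (hε : ε ∈ O) (hr : r ∈ O) :
    twist d ε r ∈ O :=
  O.add_mem (h.deriv_mem r hr) (O.mul_mem hε hr)

/-- Otherwise `x` would be invertible in `O`. This replaces comparison of leading coefficients at `x
= 0`. -/
theorem eq_zero_of_algebraMap_mul_eq (h : IsRegularAt d O x) {t : ℝ} {v w : K} (hv : v⁻¹ ∈ O)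
    (hv0 : v ≠ 0) (hw : w ∈ O) (he : algebraMap ℝ K t * v = x * w) : t = 0 := by
  by_contra ht
  apply h.inv_notMem
  have ht' : algebraMap ℝ K t ≠ 0 := by simpa using ht
  have : x⁻¹ = algebraMap ℝ K t⁻¹ * (w * v⁻¹) := by
    have := h.ne_zero
    rw [map_inv₀]
    field_simp
    linear_combination he
  rw [this]
  exact O.mul_mem (O.algebraMap_mem _) (O.mul_mem hw hv)

theorem mul_deriv_pow (h : IsRegularAt d O x) (n : ℕ) : x * d (x ^ n) = n * x ^ n := by
  rw [Derivation.leibniz_pow, h.deriv_self]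
  rcases n with _ | n
  · simp
  · simp only [Nat.add_sub_cancel, smul_eq_mul, nsmul_eq_mul]; push_cast; ring

/-- Regular eigenfunctions do not vanish at the singular point. -/
theorem inv_mem_of_laguerreOp_eq (h : IsRegularAt d O x) {a : ℝ} (ha : ∀ q : ℕ, a + q ≠ 0)
    {V ε l r : K} (hV : V ∈ O) (hε : ε ∈ O) (hl : l ∈ O) (hr : r ∈ O) (hr0 : r ≠ 0)
    (he : laguerreOp d x a V ε r = l * r) : r⁻¹ ∈ O := by
  obtain ⟨q, v, hv, hv', rfl⟩ := h.exists_eq_pow_mul r hr hr0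
  have hv0 : v ≠ 0 := right_ne_zero_of_mul hr0
  have hx0 := h.ne_zero
  rcases q with _ | p
  · simpa using hv'
  -- A zero of order `p + 1` must satisfy the indicial equation `(p + 1) * (p + a) = 0`, which `ha`
  -- excludes.
  exfalso
  have hdp : d (x ^ (p + 1)) = (p + 1) * x ^ p := by
    rw [Derivation.leibniz_pow, h.deriv_self]; simp
  set c : K := (p + 1) * v + x * twist d ε v with hc
  have hcO : c ∈ O := O.add_mem (O.mul_mem (O.add_mem (natCast_mem O p) O.one_mem) hv)
    (O.mul_mem h.self_mem (h.twist_mem hε hv))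
  have h1 : twist d ε (x ^ (p + 1) * v) = x ^ p * c := by
    rw [twist_mul, hdp, hc]; ring
  have h2 : x * twist d ε (x ^ p * c) = x ^ p * (p * c + x * twist d ε c) := by
    rw [twist_mul, mul_add, ← mul_assoc, h.mul_deriv_pow]; ring
  simp only [laguerreOp, h1, h2] at he
  have h3 : p * c + x * twist d ε c + (algebraMap ℝ K a - x) * c + V * (x * v)
      - l * (x * v) = 0 := by
    have : x ^ p * (p * c + x * twist d ε c + (algebraMap ℝ K a - x) * c + V * (x * v)
      - l * (x * v)) = 0 := by linear_combination he
    exact (mul_eq_zero.mp this).resolve_left (pow_ne_zero _ hx0)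
  have h4 : algebraMap ℝ K ((p + a) * (p + 1)) * v =
      x * (l * v + c - V * v - twist d ε c - algebraMap ℝ K (p + a) * twist d ε v) := by
    have h5 : algebraMap ℝ K (p + a) = p + algebraMap ℝ K a := by simp
    have h6 : algebraMap ℝ K (p + 1) = p + 1 := by simp
    rw [map_mul, h5, h6]
    linear_combination h3 - (p + algebraMap ℝ K a) * hc
  have h7 := h.eq_zero_of_algebraMap_mul_eq hv' hv0 (O.sub_mem (O.sub_mem (O.sub_mem
    (O.add_mem (O.mul_mem hl hv) hcO) (O.mul_mem hV hv)) (h.twist_mem hε hcO))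
    (O.mul_mem (O.algebraMap_mem _) (h.twist_mem hε hv))) h4
  have h8 : (p : ℝ) + a ≠ 0 := by rw [add_comm]; exact ha p
  have h9 : (p : ℝ) + 1 ≠ 0 := by positivity
  exact (mul_ne_zero h8 h9) h7

/-- The weighted derivative multiplies the leading coefficient at order `q` by `a + q ≠ 0`, up to
one factor `x` restored by the weight, so it cannot raise the order of vanishing. -/
theorem exists_eq_pow_mul_of_weightedDeriv_eq (h : IsRegularAt d O x) {a : ℝ}
    (ha : ∀ q : ℕ, a + q ≠ 0) {b g : K} (hb : b ∈ O) (hg : g ∈ O) {n : ℕ}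
    (he : weightedDeriv d x a b = x ^ n * g) : ∃ c ∈ O, b = x ^ n * c := by
  by_cases hb0 : b = 0
  · exact ⟨0, O.zero_mem, by simp [hb0]⟩
  obtain ⟨q, v, hv, hv', rfl⟩ := h.exists_eq_pow_mul b hb hb0
  have hv0 : v ≠ 0 := right_ne_zero_of_mul hb0
  have hx0 := h.ne_zero
  rcases le_or_gt n q with hnq | hnq
  · refine ⟨x ^ (q - n) * v, O.mul_mem (O.pow_mem h.self_mem _) hv, ?_⟩
    rw [← mul_assoc, ← pow_add, Nat.add_sub_cancel' hnq]
  exfalso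
  obtain ⟨k, rfl⟩ := Nat.exists_eq_add_of_lt hnq
  rw [weightedDeriv_pow_mul d h.deriv_self, show q + k + 1 = q + (k + 1) by ring, pow_add,
    mul_assoc] at he
  have h1 := mul_left_cancel₀ (pow_ne_zero q hx0) he
  have h2 : algebraMap ℝ K (a + q) * v = x * (x ^ k * g + v - d v) := by
    simp only [weightedDeriv] at h1
    linear_combination h1
  exact ha q (h.eq_zero_of_algebraMap_mul_eq hv' hv0 (O.sub_mem (O.add_mem
    (O.mul_mem (O.pow_mem h.self_mem _) hg) hv) (h.deriv_mem _ hv)) h2)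

/-- The norm identity for an iterated Darboux transformation: the transform of `r n` is the
quotient `s` of consecutive Wronskians, and its square agrees with a multiple of `(r n)²` up to
an exact derivative of a regular element. -/
theorem exists_pow_mul_sq_eq (h : IsRegularAt d O x) (n : ℕ) {a : ℝ} (ha : ∀ q : ℕ, a + q ≠ 0)
    {V : K} (hV : V ∈ O) (r ε : ℕ → K) (l : ℕ → ℝ) (hr : ∀ i ≤ n, r i ∈ O)
    (hε : ∀ i ≤ n, ε i ∈ O) (hεn : ε n = 0)
    (he : ∀ i ≤ n, laguerreOp d x a V (ε i) (r i) = algebraMap ℝ K (l i) * r i)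
    (hW : twistedWronskian d r ε n ≠ 0) :
    ∃ s ∈ O, ∃ b ∈ O, twistedWronskian d r ε (n + 1) = twistedWronskian d r ε n * s ∧
      x ^ n * s ^ 2 = algebraMap ℝ K (∏ i ∈ Finset.range n, (l i - l n)) * r n ^ 2 +
        weightedDeriv d x a b := by
  induction n generalizing a V r ε l with
  | zero =>
    refine ⟨r 0, hr 0 le_rfl, 0, O.zero_mem, ?_, ?_⟩
    · simp [twistedWronskian]
    · simp [weightedDeriv]
  | succ n ih =>
    have hr00 : r 0 ≠ 0 := by
      intro h0
      apply hW
      rw [twistedWronskian_succ d r ε 0 (by simp [h0, twist_zero_right]), h0, zero_mul]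
    have hinv : (r 0)⁻¹ ∈ O := h.inv_mem_of_laguerreOp_eq ha hV (hε 0 (by omega))
      (O.algebraMap_mem (l 0)) (hr 0 (by omega)) hr00 (he 0 (by omega))
    obtain ⟨u, hu⟩ : ∃ u, u = twist d (ε 0) (r 0) * (r 0)⁻¹ := ⟨_, rfl⟩
    have huO : u ∈ O := by
      rw [hu]
      exact O.mul_mem (h.twist_mem (hε 0 (by omega)) (hr 0 (by omega))) hinv
    have hu0 : twist d (ε 0) (r 0) = u * r 0 := by
      rw [hu, mul_assoc, inv_mul_cancel₀ hr00, mul_one]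
    -- The Riccati equation is the eigenvalue equation of `r 0` divided by `r 0`.
    have hRic : x * (d u + u * u) + (algebraMap ℝ K a - x) * u + V = algebraMap ℝ K (l 0) := by
      have h1 := he 0 (by omega)
      rw [laguerreOp, hu0, twist_mul, hu0] at h1
      apply mul_right_cancel₀ hr00
      linear_combination h1
    set V' : K := algebraMap ℝ K (l 0) + x * d u + u - 1 - (algebraMap ℝ K a - x) * u
      - x * (u * u) with hV'
    have hxO := h.self_mem
    have hduO := h.deriv_mem u huO
    have hV'O : V' ∈ O := O.sub_mem (O.sub_mem (O.sub_mem (O.add_mem (O.add_mem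
      (O.algebraMap_mem _) (O.mul_mem hxO hduO)) huO) O.one_mem)
      (O.mul_mem (O.sub_mem (O.algebraMap_mem _) hxO) huO)) (O.mul_mem hxO (O.mul_mem huO huO))
    have hWs := twistedWronskian_succ d r ε u hu0
    set r' : ℕ → K := fun i => twist d (ε (i + 1)) (r (i + 1)) - u * r (i + 1) with hr'
    obtain ⟨s, hs, b, hb, h1, h2⟩ := ih (a := a + 1)
      (fun q => by have := ha (q + 1); push_cast at this; rwa [add_assoc, add_comm 1 (q : ℝ)])
      hV'O r' (fun i => ε (i + 1)) (fun i => l (i + 1))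
      (fun i hi => O.sub_mem (h.twist_mem (hε _ (by omega)) (hr _ (by omega)))
        (O.mul_mem huO (hr _ (by omega))))
      (fun i hi => hε _ (by omega)) hεn
      (fun i hi => laguerreOp_darboux d h.deriv_self a hRic
        (by rw [← map_sub, Derivation.map_algebraMap]) (he (i + 1) (by omega)))
      (fun h0 => hW (by rw [hWs, h0, mul_zero]))
    have h3 := mul_sq_darboux d a hRic (by simpa only [hεn] using he (n + 1) le_rfl)
    have h4 : r' n = twist d 0 (r (n + 1)) - u * r (n + 1) := by simp only [hr', hεn]
    rw [← h4] at h3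
    -- Multiply the inductive identity by `x`, which lowers its weight from `a + 1` to `a`, and
    -- replace `x * r' n ^ 2` by the single-step identity; each contributes one exact term.
    refine ⟨s, hs, x ^ 1 * b + algebraMap ℝ K (∏ i ∈ Finset.range n, (l (i + 1) - l (n + 1))) *
      (r (n + 1) * r' n), ?_, ?_, ?_⟩
    · exact O.add_mem (O.mul_mem (O.pow_mem hxO _) hb) (O.mul_mem (O.algebraMap_mem _)
        (O.mul_mem (hr _ le_rfl) (h4 ▸ O.sub_mem (h.twist_mem O.zero_mem (hr _ le_rfl))
          (O.mul_mem huO (hr _ le_rfl)))))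
    · rw [hWs, hWs, h1]; ring
    · rw [weightedDeriv_add, weightedDeriv_pow_mul d h.deriv_self, weightedDeriv_algebraMap_mul,
        Finset.prod_range_succ', map_mul, map_sub, Nat.cast_one, pow_one, pow_succ']
      linear_combination x * h2 +
        algebraMap ℝ K (∏ i ∈ Finset.range n, (l (i + 1) - l (n + 1))) * h3

end IsRegularAt

end Darboux

/-! ### The differential field of real rational functions and its local ring at zero. -/

section RatFunc

/-- The derivative of a rational function, by the quotient rule in lowest terms. -/
noncomputable def ratFuncDerivFun (r : RatFunc ℝ) : RatFunc ℝ :=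
  (algebraMap ℝ[X] (RatFunc ℝ) (derivative r.num) * algebraMap ℝ[X] (RatFunc ℝ) r.denom -
    algebraMap ℝ[X] (RatFunc ℝ) r.num * algebraMap ℝ[X] (RatFunc ℝ) (derivative r.denom)) /
      algebraMap ℝ[X] (RatFunc ℝ) r.denom ^ 2

theorem algebraMap_ratFunc_ne_zero {p : ℝ[X]} (hp : p ≠ 0) :
    algebraMap ℝ[X] (RatFunc ℝ) p ≠ 0 := by
  simpa using hp

/-- The quotient rule is independent of the representative, so the derivation laws can be checked on
arbitrary fractions. -/
theorem ratFuncDerivFun_div (p : ℝ[X]) {q : ℝ[X]} (hq : q ≠ 0) :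
    ratFuncDerivFun (algebraMap ℝ[X] (RatFunc ℝ) p / algebraMap ℝ[X] (RatFunc ℝ) q) =
      (algebraMap ℝ[X] (RatFunc ℝ) (derivative p) * algebraMap ℝ[X] (RatFunc ℝ) q -
        algebraMap ℝ[X] (RatFunc ℝ) p * algebraMap ℝ[X] (RatFunc ℝ) (derivative q)) /
          algebraMap ℝ[X] (RatFunc ℝ) q ^ 2 := by
  set r := algebraMap ℝ[X] (RatFunc ℝ) p / algebraMap ℝ[X] (RatFunc ℝ) q with hr
  have h1 : r.num * q = p * r.denom := (RatFunc.num_mul_eq_mul_denom_iff hq).mpr rfl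
  have h2 := congrArg derivative h1
  simp only [derivative_mul] at h2
  have h3 := congrArg (algebraMap ℝ[X] (RatFunc ℝ)) h1
  have h4 := congrArg (algebraMap ℝ[X] (RatFunc ℝ)) h2
  simp only [map_mul, map_add] at h3 h4
  have hq' := algebraMap_ratFunc_ne_zero hq
  have hd' := algebraMap_ratFunc_ne_zero r.denom_ne_zero
  rw [ratFuncDerivFun, div_eq_div_iff (pow_ne_zero 2 hd') (pow_ne_zero 2 hq')]
  linear_combination algebraMap ℝ[X] (RatFunc ℝ) q * algebraMap ℝ[X] (RatFunc ℝ) r.denom * h4 -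
    (algebraMap ℝ[X] (RatFunc ℝ) (derivative r.denom) * algebraMap ℝ[X] (RatFunc ℝ) q +
    algebraMap ℝ[X] (RatFunc ℝ) (derivative q) * algebraMap ℝ[X] (RatFunc ℝ) r.denom) * h3

theorem exists_ratFunc_eq_div (r : RatFunc ℝ) : ∃ p q : ℝ[X], q ≠ 0 ∧
    r = algebraMap ℝ[X] (RatFunc ℝ) p / algebraMap ℝ[X] (RatFunc ℝ) q :=
  ⟨r.num, r.denom, r.denom_ne_zero, r.num_div_denom.symm⟩

/-- The derivation of `ℝ(X)` extending the derivative of polynomials. -/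
noncomputable def ratFuncDeriv : Derivation ℝ (RatFunc ℝ) (RatFunc ℝ) :=
  Derivation.mk'
    { toFun := ratFuncDerivFun
      map_add' := fun r s => by
        obtain ⟨p, q, hq, rfl⟩ := exists_ratFunc_eq_div r
        obtain ⟨p', q', hq', rfl⟩ := exists_ratFunc_eq_div s
        have h1 := algebraMap_ratFunc_ne_zero hq
        have h2 := algebraMap_ratFunc_ne_zero hq'
        rw [div_add_div _ _ h1 h2, ratFuncDerivFun_div _ hq, ratFuncDerivFun_div _ hq',
          ← map_mul, ← map_mul, ← map_mul, ← map_add, ratFuncDerivFun_div _ (mul_ne_zero hq hq')]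
        simp only [derivative_mul, map_mul, map_add]
        field_simp
        ring
      map_smul' := fun c r => by
        obtain ⟨p, q, hq, rfl⟩ := exists_ratFunc_eq_div r
        have h1 := algebraMap_ratFunc_ne_zero hq
        have h2 : c • (algebraMap ℝ[X] (RatFunc ℝ) p / algebraMap ℝ[X] (RatFunc ℝ) q) =
            algebraMap ℝ[X] (RatFunc ℝ) (C c * p) / algebraMap ℝ[X] (RatFunc ℝ) q := by
          rw [Algebra.smul_def, map_mul, IsScalarTower.algebraMap_apply ℝ ℝ[X] (RatFunc ℝ),
            Polynomial.algebraMap_eq, mul_div_assoc]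
        rw [h2, ratFuncDerivFun_div _ hq, ratFuncDerivFun_div _ hq, Algebra.smul_def,
          IsScalarTower.algebraMap_apply ℝ ℝ[X] (RatFunc ℝ), Polynomial.algebraMap_eq]
        simp only [derivative_mul, derivative_C, zero_mul, zero_add, map_mul, RingHom.id_apply]
        ring }
    fun r s => by
      obtain ⟨p, q, hq, rfl⟩ := exists_ratFunc_eq_div r
      obtain ⟨p', q', hq', rfl⟩ := exists_ratFunc_eq_div s
      have h1 := algebraMap_ratFunc_ne_zero hq
      have h2 := algebraMap_ratFunc_ne_zero hq'
      simp only [LinearMap.coe_mk, AddHom.coe_mk, smul_eq_mul]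
      rw [div_mul_div_comm, ratFuncDerivFun_div _ hq, ratFuncDerivFun_div _ hq',
        ← map_mul, ← map_mul, ratFuncDerivFun_div _ (mul_ne_zero hq hq')]
      simp only [derivative_mul, map_mul, map_add]
      field_simp
      ring

theorem ratFuncDeriv_div (p : ℝ[X]) {q : ℝ[X]} (hq : q ≠ 0) :
    ratFuncDeriv (algebraMap ℝ[X] (RatFunc ℝ) p / algebraMap ℝ[X] (RatFunc ℝ) q) =
      (algebraMap ℝ[X] (RatFunc ℝ) (derivative p) * algebraMap ℝ[X] (RatFunc ℝ) q -
        algebraMap ℝ[X] (RatFunc ℝ) p * algebraMap ℝ[X] (RatFunc ℝ) (derivative q)) /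
          algebraMap ℝ[X] (RatFunc ℝ) q ^ 2 :=
  ratFuncDerivFun_div p hq

theorem ratFuncDeriv_algebraMap (p : ℝ[X]) :
    ratFuncDeriv (algebraMap ℝ[X] (RatFunc ℝ) p) =
      algebraMap ℝ[X] (RatFunc ℝ) (derivative p) := by
  have := ratFuncDeriv_div p one_ne_zero
  simpa using this

/-- The rational functions without a pole at `0`. -/
noncomputable def regularAtZero : Subalgebra ℝ (RatFunc ℝ) where
  carrier := {r | r.denom.eval 0 ≠ 0}
  mul_mem' {r s} hr hs := by
    intro h0
    have := eval_eq_zero_of_dvd_of_eval_eq_zero (RatFunc.denom_mul_dvd r s) h0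
    rw [eval_mul] at this
    exact mul_ne_zero hr hs this
  add_mem' {r s} hr hs := by
    intro h0
    have := eval_eq_zero_of_dvd_of_eval_eq_zero (RatFunc.denom_add_dvd r s) h0
    rw [eval_mul] at this
    exact mul_ne_zero hr hs this
  algebraMap_mem' c := by
    rw [Set.mem_ofPred_eq, IsScalarTower.algebraMap_apply ℝ ℝ[X] (RatFunc ℝ),
      RatFunc.denom_algebraMap]
    simp

theorem div_mem_regularAtZero (p : ℝ[X]) {q : ℝ[X]} (hq : q.eval 0 ≠ 0) :
    algebraMap ℝ[X] (RatFunc ℝ) p / algebraMap ℝ[X] (RatFunc ℝ) q ∈ regularAtZero :=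
  fun h0 => hq (eval_eq_zero_of_dvd_of_eval_eq_zero (RatFunc.denom_div_dvd p q) h0)

theorem algebraMap_mem_regularAtZero (p : ℝ[X]) :
    algebraMap ℝ[X] (RatFunc ℝ) p ∈ regularAtZero := by
  simpa using div_mem_regularAtZero p (q := 1) (by simp)

theorem isRegularAt_regularAtZero :
    IsRegularAt ratFuncDeriv regularAtZero (algebraMap ℝ[X] (RatFunc ℝ) X) where
  deriv_self := by rw [ratFuncDeriv_algebraMap]; simp
  self_mem := algebraMap_mem_regularAtZero X
  inv_notMem h := by
    set r := (algebraMap ℝ[X] (RatFunc ℝ) X)⁻¹ with hr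
    have h1 : r = algebraMap ℝ[X] (RatFunc ℝ) 1 / algebraMap ℝ[X] (RatFunc ℝ) X := by
      rw [hr, map_one, one_div]
    have h2 := (RatFunc.num_mul_eq_mul_denom_iff X_ne_zero).mpr h1
    apply h
    have h3 := congrArg (eval 0) h2
    simpa using h3.symm
  deriv_mem r hr := by
    have h1 : r.denom ≠ 0 := r.denom_ne_zero
    rw [← r.num_div_denom, ratFuncDeriv_div _ h1, ← map_mul, ← map_mul, ← map_sub, ← map_pow]
    exact div_mem_regularAtZero _ (by rw [eval_pow]; exact pow_ne_zero 2 hr)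
  exists_eq_pow_mul r hr hr0 := by
    have hn : r.num ≠ 0 := RatFunc.num_ne_zero hr0
    obtain ⟨w, hw, hnd⟩ := exists_eq_pow_rootMultiplicity_mul_and_not_dvd r.num hn 0
    have hw0 : w.eval 0 ≠ 0 := by
      rwa [Ne, ← IsRoot.def, ← dvd_iff_isRoot]
    refine ⟨rootMultiplicity 0 r.num,
      algebraMap ℝ[X] (RatFunc ℝ) w / algebraMap ℝ[X] (RatFunc ℝ) r.denom,
      div_mem_regularAtZero _ hr, ?_, ?_⟩
    · rw [inv_div]; exact div_mem_regularAtZero _ hw0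
    · conv_lhs => rw [← r.num_div_denom, hw]
      simp only [C_0, sub_zero, map_mul, map_pow]
      ring

end RatFunc

/-! ### Classical identities for Laguerre polynomials. -/

namespace ExceptionalLaguerre

theorem coeff_laguerre (n : ℕ) (α : ℝ) (j : ℕ) :
    (laguerre n α).coeff j =
      if j ≤ n then (-1) ^ j * (Ring.choose ((n : ℝ) + α) (n - j) / (j.factorial : ℝ)) else 0 := by
  have h : ∀ i : ℕ, C (Ring.choose ((n : ℝ) + α) (n - i) / (i.factorial : ℝ)) * (-X : ℝ[X]) ^ i =
      C ((-1) ^ i * (Ring.choose ((n : ℝ) + α) (n - i) / (i.factorial : ℝ))) * X ^ i := by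
    intro i
    rw [neg_pow, C_mul, C_pow, C_neg, C_1]; ring
  simp only [laguerre, finsetSum_coeff, h, coeff_C_mul_X_pow]
  rw [Finset.sum_ite_eq]
  simp

theorem laguerre_ne_zero (n : ℕ) (α : ℝ) : laguerre n α ≠ 0 := by
  intro h
  have := congrArg (fun p => coeff p n) h
  simp [coeff_laguerre, Nat.factorial_ne_zero] at this

/-- Pascal's rule, coefficient by coefficient. Up to sign, raising `α` by one is the Darboux step
with seed `e^x`. -/
theorem laguerre_add_one (n : ℕ) (α : ℝ) :
    laguerre n (α + 1) = laguerre n α - derivative (laguerre n α) := by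
  ext j
  rw [coeff_sub, coeff_derivative]
  simp only [coeff_laguerre]
  rcases lt_trichotomy j n with h | h | h
  · obtain ⟨m, rfl⟩ := Nat.exists_eq_add_of_lt h
    rw [if_pos (by omega), if_pos (by omega), if_pos (by omega),
      show j + m + 1 - j = m + 1 by omega, show j + m + 1 - (j + 1) = m by omega,
      ← add_assoc, Ring.choose_succ_succ, Nat.factorial_succ]
    have : (j.factorial : ℝ) ≠ 0 := by positivity
    have : (j : ℝ) + 1 ≠ 0 := by positivity
    push_cast
    field_simp
    ring
  · subst h; simp
  · rw [if_neg (by omega), if_neg (by omega), if_neg (by omega)]; simp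

theorem choose_succ_mul (a : ℝ) (m : ℕ) :
    Ring.choose a (m + 1) * (m + 1) = Ring.choose a m * (a - m) := by
  rw [Ring.choose_eq_smul, Ring.choose_eq_smul, descPochhammer_succ_right, Nat.factorial_succ,
    smeval_mul]
  have : (m.factorial : ℝ) ≠ 0 := by positivity
  have : (m : ℝ) + 1 ≠ 0 := by positivity
  simp [smeval_sub, smeval_natCast]
  field_simp

theorem laguerre_ode (n : ℕ) (α : ℝ) :
    X * derivative (derivative (laguerre n α)) + (C (α + 1) - X) * derivative (laguerre n α) =
      C (-(n : ℝ)) * laguerre n α := by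
  have key : ∀ j : ℕ, ((j : ℝ) + 1) * (j + 1 + α) * (laguerre n α).coeff (j + 1) =
      ((j : ℝ) - n) * (laguerre n α).coeff j := by
    intro j
    simp only [coeff_laguerre]
    rcases lt_trichotomy j n with h | h | h
    · obtain ⟨m, rfl⟩ := Nat.exists_eq_add_of_lt h
      rw [if_pos (by omega), if_pos (by omega),
        show j + m + 1 - j = m + 1 by omega, show j + m + 1 - (j + 1) = m by omega,
        Nat.factorial_succ]
      have h1 := choose_succ_mul (((j + m + 1 : ℕ) : ℝ) + α) m
      have : (j.factorial : ℝ) ≠ 0 := by positivity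
      have : (j : ℝ) + 1 ≠ 0 := by positivity
      push_cast at h1 ⊢
      field_simp
      linear_combination (-1) ^ j * h1
    · subst h; simp
    · rw [if_neg (by omega), if_neg (by omega)]; simp
  ext j
  rcases j with _ | j
  · have := key 0
    simp [sub_mul, coeff_derivative] at this ⊢
    linear_combination this
  · have := key (j + 1)
    simp only [sub_mul, coeff_add, coeff_sub, coeff_X_mul, coeff_C_mul, coeff_derivative] at this ⊢
    push_cast at this ⊢
    linear_combination this

end ExceptionalLaguerre

/-! ### Poles, decay and monotonicity on the half-line. -/

section WeightedEquation

/-- A rational function `n / m` in lowest terms whose weighted derivative has no poles on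
`(0, ∞)` has itself no poles there. -/
theorem eval_denom_ne_zero_of_weighted_eq {w n m q : ℝ[X]} {β : ℝ} (hnm : IsCoprime n m)
    (hm0 : m ≠ 0)
    (h : w ^ 2 * (X * (derivative n * m - n * derivative m) + (C β - X) * (n * m)) = m ^ 2 * q)
    {t : ℝ} (ht : 0 < t) (hw : w.eval t ≠ 0) : m.eval t ≠ 0 := by
  intro hmt
  obtain ⟨v, hv, hnd⟩ := exists_eq_pow_rootMultiplicity_mul_and_not_dvd m hm0 t
  have hvt : v.eval t ≠ 0 := by rwa [Ne, ← IsRoot.def, ← dvd_iff_isRoot]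
  have hnt : n.eval t ≠ 0 := by
    intro hn
    obtain ⟨a, b, hab⟩ := hnm
    simpa [hn, hmt] using congrArg (eval t) hab
  obtain ⟨p, hp⟩ : ∃ p, rootMultiplicity t m = p + 1 :=
    Nat.exists_eq_succ_of_ne_zero ((rootMultiplicity_pos hm0).mpr hmt).ne'
  rw [hp] at hv
  have hdm : derivative m = (X - C t) ^ p * (((p : ℝ[X]) + 1) * v + (X - C t) * derivative v) := by
    rw [hv, derivative_mul, derivative_X_sub_C_pow]
    push_cast
    simp only [map_add, map_natCast, map_one]
    ring
  -- With `m` vanishing to order `p + 1` at `t`, the term containing `derivative m` has order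
  -- exactly `p` there, and all others have order at least `p + 1`.
  have h1 : (X - C t) ^ p * (w ^ 2 * X * n * (((p : ℝ[X]) + 1) * v + (X - C t) * derivative v)) =
      (X - C t) ^ p * ((X - C t) * (v *
        (w ^ 2 * (X * derivative n + (C β - X) * n) - m * q))) := by
    rw [hdm] at h
    have h2 : m = (X - C t) ^ p * ((X - C t) * v) := by rw [hv]; ring
    calc _ = w ^ 2 * (X * (derivative n * m) + (C β - X) * (n * m)) - m ^ 2 * q := by
          linear_combination -h
      _ = m * (w ^ 2 * (X * derivative n + (C β - X) * n) - m * q) := by ring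
      _ = (X - C t) ^ p * ((X - C t) * v) *
          (w ^ 2 * (X * derivative n + (C β - X) * n) - m * q) := by rw [← h2]
      _ = _ := by ring
  have h3 := congrArg (eval t) (mul_left_cancel₀ (pow_ne_zero p (X_sub_C_ne_zero t)) h1)
  simp only [eval_mul, eval_add, eval_sub, eval_X, eval_C, eval_pow, eval_natCast, eval_one,
    sub_self, zero_mul, add_zero] at h3
  have h4 : (p : ℝ) + 1 ≠ 0 := by positivity
  exact mul_ne_zero (mul_ne_zero (mul_ne_zero (pow_ne_zero 2 hw) ht.ne') hnt)
    (mul_ne_zero h4 hvt) h3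

open Filter Topology Asymptotics in
theorem tendsto_rpow_mul_exp_neg_mul_eval_div_eval (n : ℝ[X]) {m : ℝ[X]} (hm : m ≠ 0) (β : ℝ) :
    Tendsto (fun x : ℝ => x ^ β * Real.exp (-x) * (n.eval x / m.eval x)) atTop (𝓝 0) := by
  have h1 : (fun x : ℝ => n.eval x) =O[atTop] fun x : ℝ => (X ^ n.natDegree : ℝ[X]).eval x :=
    isBigO_atTop_of_degree_le _ _ (by rw [degree_X_pow]; exact degree_le_natDegree)
  have h2 : (fun x : ℝ => (1 : ℝ[X]).eval x) =O[atTop] fun x : ℝ => m.eval x :=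
    isBigO_atTop_of_degree_le _ _ (by rw [degree_one]; exact zero_le_degree_iff.mpr hm)
  have h3 : (fun x : ℝ => (m.eval x)⁻¹) =O[atTop] fun _ : ℝ => (1 : ℝ) := by
    have := h2.inv_rev (by simp)
    simpa using this
  have h4 : (fun x : ℝ => x ^ β * Real.exp (-x) * (n.eval x / m.eval x)) =O[atTop]
      fun x : ℝ => x ^ (β + n.natDegree) * Real.exp (-1 * x) := by
    have h5 := ((isBigO_refl (fun x : ℝ => x ^ β * Real.exp (-x)) atTop).mul (h1.mul h3))
    refine (h5.congr_left fun x => by rw [div_eq_mul_inv]).trans_eventuallyEq ?_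
    filter_upwards [eventually_gt_atTop 0] with x hx
    rw [Real.rpow_add hx, Real.rpow_natCast]
    simp
    ring
  exact h4.trans_tendsto (tendsto_rpow_mul_exp_neg_mul_atTop_nhds_zero _ 1 one_pos)

open Filter Topology in
/-- If the weighted derivative of a rational function without poles on `[0, ∞)` is nonnegative
there, then it vanishes, as the weighted function tends to `0` at both ends. -/
theorem eval_eq_zero_of_weighted_eq {w n m q : ℝ[X]} {β : ℝ} (hβ : 0 < β)
    (hw : ∀ x : ℝ, 0 < x → w.eval x ≠ 0) (hm : ∀ x : ℝ, 0 ≤ x → m.eval x ≠ 0)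
    (h : w ^ 2 * (X * (derivative n * m - n * derivative m) + (C β - X) * (n * m)) = m ^ 2 * q)
    (hq : ∀ x : ℝ, 0 < x → 0 ≤ q.eval x) {x : ℝ} (hx : 0 < x) : q.eval x = 0 := by
  set G : ℝ → ℝ := fun x => x ^ β * Real.exp (-x) * (n.eval x / m.eval x) with hG
  have hderiv : ∀ x : ℝ, 0 < x → HasDerivAt G
      (x ^ (β - 1) * Real.exp (-x) * (q.eval x / w.eval x ^ 2)) x := by
    intro x hx
    have h1 : HasDerivAt (fun x : ℝ => x ^ β) (β * x ^ (β - 1)) x :=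
      Real.hasDerivAt_rpow_const (Or.inl hx.ne')
    have h2 : HasDerivAt (fun x : ℝ => Real.exp (-x)) (Real.exp (-x) * (-1)) x :=
      (hasDerivAt_neg x).exp
    have h3 := (h1.mul h2).mul ((n.hasDerivAt x).div (m.hasDerivAt x) (hm x hx.le))
    refine h3.congr_deriv ?_
    have h4 := congrArg (eval x) h
    simp only [eval_mul, eval_add, eval_sub, eval_X, eval_C, eval_pow] at h4
    have h5 := hm x hx.le
    have h6 := hw x hx
    have h7 : x ^ β = x ^ (β - 1) * x := by
      rw [← Real.rpow_add_one hx.ne', sub_add_cancel]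
    have h8 : eval x q / eval x w ^ 2 = (x * (eval x (derivative n) * eval x m -
        eval x n * eval x (derivative m)) + (β - x) * (eval x n * eval x m)) / eval x m ^ 2 := by
      rw [div_eq_div_iff (pow_ne_zero 2 h6) (pow_ne_zero 2 h5)]
      linear_combination -h4
    rw [h8]
    simp only [h7, Pi.mul_apply, Pi.div_apply]
    field_simp
    ring
  have hcont : ContinuousOn G (Set.Ici 0) := by
    refine ContinuousOn.mul (ContinuousOn.mul ?_ ?_) ?_
    · exact (Real.continuous_rpow_const hβ.le).continuousOn
    · fun_prop
    · exact n.continuous.continuousOn.div m.continuous.continuousOn fun x hx => hm x hx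
  have hmono : MonotoneOn G (Set.Ici 0) := by
    refine monotoneOn_of_deriv_nonneg (convex_Ici 0) hcont ?_ ?_
    · rw [interior_Ici]
      exact fun x hx => (hderiv x hx).differentiableAt.differentiableWithinAt
    · rw [interior_Ici]
      intro x hx
      have hx' : 0 < x := hx
      rw [(hderiv x hx).deriv]
      have := hq x hx
      positivity
  have hG0 : G 0 = 0 := by simp [hG, Real.zero_rpow hβ.ne']
  have hlim := tendsto_rpow_mul_exp_neg_mul_eval_div_eval n (m := m)
    (fun h0 => hm 0 le_rfl (by simp [h0])) β
  -- A monotone function that starts at `0` and tends to `0` is zero.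
  have hzero : ∀ y : ℝ, 0 ≤ y → G y = 0 := by
    intro y hy
    refine le_antisymm ?_ (hG0 ▸ hmono Set.self_mem_Ici hy hy)
    refine ge_of_tendsto hlim ?_
    filter_upwards [eventually_ge_atTop y] with z hz
    exact hmono hy (hy.trans hz) hz
  have h1 : HasDerivAt G 0 x := by
    refine (hasDerivAt_const x (0 : ℝ)).congr_of_eventuallyEq ?_
    filter_upwards [eventually_gt_nhds hx] with y hy
    exact hzero y hy.le
  have h2 := (hderiv x hx).unique h1
  have h3 : x ^ (β - 1) * Real.exp (-x) ≠ 0 := by positivity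
  have h4 := (mul_eq_zero.mp h2).resolve_left h3
  exact (div_eq_zero_iff.mp h4).resolve_right (pow_ne_zero 2 (hw x hx))

end WeightedEquation

/-! ### The Wronskian form of `Ω` and the two norm identities. -/

namespace ExceptionalLaguerre

/-- This is `(e^x p(-x))' = e^x (p - p')(-x)`; it turns the parameter shifts in the `F₂` rows into
twisted derivatives. -/
theorem comp_neg_X_twist (p : ℝ[X]) :
    twist derivative' 1 (p.comp (-X)) = (p - derivative p).comp (-X) := by
  simp [twist, derivative_comp]
  ring

theorem twist_iterate_laguerre_comp (n : ℕ) (α : ℝ) (j : ℕ) :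
    (twist derivative' 1)^[j] ((laguerre n α).comp (-X)) = (laguerre n (α + j)).comp (-X) := by
  induction j with
  | zero => simp
  | succ j ih =>
    rw [Function.iterate_succ_apply', ih, comp_neg_X_twist, ← laguerre_add_one, Nat.cast_succ,
      add_assoc]

/-- The sequence of eigenfunctions whose twisted Wronskian is `Ω_F^α`, followed by `L_n^α`. -/
noncomputable def seed (F₁ F₂ : Finset ℕ) (α : ℝ) (n i : ℕ) : ℝ[X] :=
  if h : i < F₁.card then laguerre (F₁.orderEmbOfFin rfl ⟨i, h⟩) α
  else if h : i - F₁.card < F₂.card then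
    (laguerre (F₂.orderEmbOfFin rfl ⟨i - F₁.card, h⟩) α).comp (-X)
  else laguerre n α

/-- The twists belonging to `seed`: the second group of seeds carries a factor `e^x`. -/
def seedTwist (F₁ F₂ : Finset ℕ) (i : ℕ) : ℝ :=
  if i < F₁.card then 0 else if i - F₁.card < F₂.card then 1 else 0

/-- The eigenvalues of `seed` under `x D² + (α + 1 - x) D`. -/
noncomputable def seedEigenvalue (F₁ F₂ : Finset ℕ) (α : ℝ) (n i : ℕ) : ℝ :=
  if h : i < F₁.card then -((F₁.orderEmbOfFin rfl ⟨i, h⟩ : ℕ) : ℝ)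
  else if h : i - F₁.card < F₂.card then
    ((F₂.orderEmbOfFin rfl ⟨i - F₁.card, h⟩ : ℕ) : ℝ) + (α + 1)
  else -(n : ℝ)

theorem omega_eq_twistedWronskian (F₁ F₂ : Finset ℕ) (α : ℝ) (n : ℕ) :
    omega F₁ F₂ α = twistedWronskian derivative' (seed F₁ F₂ α n)
      (fun i => C (seedTwist F₁ F₂ i)) (F₁.card + F₂.card) := by
  unfold omega twistedWronskian
  congr 1
  ext1 i j
  have h0 : twist (derivative' (R := ℝ)) 0 = ⇑(derivative (R := ℝ)) := by
    funext p; simp [twist]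
  induction i using Fin.addCases with
  | left a =>
    simp [omegaMatrix, seed, seedTwist, h0]
  | right b =>
    simp [omegaMatrix, seed, seedTwist, twist_iterate_laguerre_comp]

theorem laguerre_comp_ode (n : ℕ) (α : ℝ) :
    X * twist derivative' 1 (twist derivative' 1 ((laguerre n α).comp (-X))) +
      (C (α + 1) - X) * twist derivative' 1 ((laguerre n α).comp (-X)) =
      C ((n : ℝ) + (α + 1)) * (laguerre n α).comp (-X) := by
  have h := congrArg (fun p => p.comp (-X)) (laguerre_ode n α)
  simp only [add_comp, mul_comp, sub_comp, X_comp, C_comp] at h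
  rw [comp_neg_X_twist, comp_neg_X_twist]
  simp only [derivative_sub, sub_comp, C_add] at h ⊢
  rw [C_neg] at h
  linear_combination -h

theorem seed_ode (F₁ F₂ : Finset ℕ) (α : ℝ) (n i : ℕ) :
    X * twist derivative' (C (seedTwist F₁ F₂ i))
        (twist derivative' (C (seedTwist F₁ F₂ i)) (seed F₁ F₂ α n i)) +
      (C (α + 1) - X) * twist derivative' (C (seedTwist F₁ F₂ i)) (seed F₁ F₂ α n i) =
      C (seedEigenvalue F₁ F₂ α n i) * seed F₁ F₂ α n i := by
  have h0 : ∀ p : ℝ[X], twist (derivative' (R := ℝ)) 0 p = derivative p := by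
    intro p; simp [twist]
  unfold seed seedTwist seedEigenvalue
  split_ifs
  · rw [C_0, h0, h0]; exact laguerre_ode _ α
  · rw [C_1]; exact laguerre_comp_ode _ α
  · rw [C_0, h0, h0]; exact laguerre_ode n α

theorem algebraMap_real_ratFunc (a : ℝ) :
    algebraMap ℝ (RatFunc ℝ) a = algebraMap ℝ[X] (RatFunc ℝ) (C a) := by
  rw [IsScalarTower.algebraMap_apply ℝ ℝ[X] (RatFunc ℝ), Polynomial.algebraMap_eq]

theorem algebraMap_derivative' (p : ℝ[X]) :
    algebraMap ℝ[X] (RatFunc ℝ) (derivative' p) =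
      ratFuncDeriv (algebraMap ℝ[X] (RatFunc ℝ) p) :=
  (ratFuncDeriv_algebraMap p).symm

theorem algebraMap_twist (e p : ℝ[X]) :
    algebraMap ℝ[X] (RatFunc ℝ) (twist derivative' e p) =
      twist ratFuncDeriv (algebraMap ℝ[X] (RatFunc ℝ) e) (algebraMap ℝ[X] (RatFunc ℝ) p) :=
  map_twist_iterate derivative' ratFuncDeriv _ algebraMap_derivative' e p 1

theorem laguerreOp_algebraMap {a l : ℝ} {e p : ℝ[X]}
    (h : X * twist derivative' e (twist derivative' e p) + (C a - X) * twist derivative' e p =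
      C l * p) :
    laguerreOp ratFuncDeriv (algebraMap ℝ[X] (RatFunc ℝ) X) a 0 (algebraMap ℝ[X] (RatFunc ℝ) e)
      (algebraMap ℝ[X] (RatFunc ℝ) p) =
        algebraMap ℝ (RatFunc ℝ) l * algebraMap ℝ[X] (RatFunc ℝ) p := by
  have h1 := congrArg (algebraMap ℝ[X] (RatFunc ℝ)) h
  simp only [map_add, map_mul, map_sub, algebraMap_twist, ← algebraMap_real_ratFunc] at h1
  rw [laguerreOp, h1, zero_mul, add_zero]

theorem prod_seedEigenvalue_sub (F₁ F₂ : Finset ℕ) (α : ℝ) (n : ℕ) :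
    ∏ i ∈ Finset.range (F₁.card + F₂.card),
      (seedEigenvalue F₁ F₂ α n i - seedEigenvalue F₁ F₂ α n (F₁.card + F₂.card)) =
      (∏ f ∈ F₁, ((n : ℝ) - (f : ℝ))) * ∏ f ∈ F₂, ((n : ℝ) + (α + 1) + (f : ℝ)) := by
  have h1 : ∀ (F : Finset ℕ) (g : ℕ → ℝ),
      ∏ f ∈ F, g f = ∏ i : Fin F.card, g (F.orderEmbOfFin rfl i) := by
    intro F g
    conv_lhs => rw [← Finset.map_orderEmbOfFin_univ F rfl]
    rw [Finset.prod_map]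
    rfl
  have h2 : seedEigenvalue F₁ F₂ α n (F₁.card + F₂.card) = -(n : ℝ) := by
    simp [seedEigenvalue]
  rw [Finset.prod_range, Fin.prod_univ_add, h1, h1, h2]
  congr 1
  · refine Finset.prod_congr rfl fun i _ => ?_
    simp [seedEigenvalue]
    ring
  · refine Finset.prod_congr rfl fun i _ => ?_
    simp [seedEigenvalue]
    ring

/-- Iterates the Darboux step with seed `e^x`, that is `u = 1`. At parameter `α` it contributes the
eigenvalue difference `n + α + 1`, and these factors build the Pochhammer symbol. -/
theorem exists_pow_mul_laguerre_sq_eq (n : ℕ) (α : ℝ) (N : ℕ) :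
    ∃ b ∈ regularAtZero,
      algebraMap ℝ[X] (RatFunc ℝ) X ^ N *
          algebraMap ℝ[X] (RatFunc ℝ) (laguerre n (α + N)) ^ 2 =
        algebraMap ℝ (RatFunc ℝ) ((ascPochhammer ℝ N).eval ((n : ℝ) + (α + 1))) *
          algebraMap ℝ[X] (RatFunc ℝ) (laguerre n α) ^ 2 +
        weightedDeriv ratFuncDeriv (algebraMap ℝ[X] (RatFunc ℝ) X) (α + 1) b := by
  have hreg := isRegularAt_regularAtZero
  induction N generalizing α with
  | zero => exact ⟨0, Subalgebra.zero_mem _, by simp [weightedDeriv]⟩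
  | succ N ih =>
    obtain ⟨b, hb, hbe⟩ := ih (α + 1)
    set x := algebraMap ℝ[X] (RatFunc ℝ) X with hx
    set y := algebraMap ℝ[X] (RatFunc ℝ) (laguerre n α) with hy
    have h0 : laguerreOp ratFuncDeriv x (α + 1) 0 0 y =
        algebraMap ℝ (RatFunc ℝ) (-(n : ℝ)) * y := by
      have := laguerreOp_algebraMap (a := α + 1) (l := -(n : ℝ)) (e := 0) (p := laguerre n α)
        (by simpa [twist] using laguerre_ode n α)
      simpa only [map_zero] using this
    have h1 := mul_sq_darboux ratFuncDeriv (x := x) (α + 1) (V := 0) (u := 1)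
      (l := algebraMap ℝ (RatFunc ℝ) (α + 1)) (by rw [Derivation.map_one_eq_zero]; ring) h0
    have h2 : twist ratFuncDeriv 0 y - 1 * y =
        -algebraMap ℝ[X] (RatFunc ℝ) (laguerre n (α + 1)) := by
      rw [laguerre_add_one, map_sub, ← ratFuncDeriv_algebraMap, twist]; ring
    rw [h2, neg_sq, ← map_sub] at h1
    have hcast : ((N + 1 : ℕ) : ℝ) = N + 1 := by push_cast; ring
    have hasc : (ascPochhammer ℝ (N + 1)).eval ((n : ℝ) + (α + 1)) =
        (ascPochhammer ℝ N).eval ((n : ℝ) + (α + 1 + 1)) * (α + 1 - -(n : ℝ)) := by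
      rw [ascPochhammer_succ_left]
      simp only [eval_mul, eval_X, eval_comp, eval_add, eval_one]
      rw [show (n : ℝ) + (α + 1) + 1 = n + (α + 1 + 1) by ring]
      ring
    refine ⟨x ^ 1 * b + algebraMap ℝ (RatFunc ℝ)
      ((ascPochhammer ℝ N).eval ((n : ℝ) + (α + 1 + 1))) *
        (y * -algebraMap ℝ[X] (RatFunc ℝ) (laguerre n (α + 1))), ?_, ?_⟩
    · exact add_mem (mul_mem (pow_mem hreg.self_mem _) hb) (mul_mem (Subalgebra.algebraMap_mem _ _)
        (mul_mem (algebraMap_mem_regularAtZero _) (neg_mem (algebraMap_mem_regularAtZero _))))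
    · rw [weightedDeriv_add, weightedDeriv_pow_mul _ hreg.deriv_self,
        weightedDeriv_algebraMap_mul, hasc, map_mul, Nat.cast_one, pow_one, hcast,
        show α + ((N : ℝ) + 1) = α + 1 + N by ring, pow_succ']
      linear_combination x * hbe + algebraMap ℝ (RatFunc ℝ)
        ((ascPochhammer ℝ N).eval ((n : ℝ) + (α + 1 + 1))) * h1

/-- Though intermediate steps divide by other Wronskians, the final transform has only `Ω` as
denominator. The term `b` may still have poles away from `0`; these are excluded later. -/
theorem exists_pow_mul_sq_eq_omega (F₁ F₂ : Finset ℕ) {α : ℝ}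
    (hα : ∀ q : ℕ, α + 1 + q ≠ 0) (hΩ : omega F₁ F₂ α ≠ 0) (n : ℕ) :
    ∃ p : ℝ[X], ∃ b ∈ regularAtZero,
      algebraMap ℝ[X] (RatFunc ℝ) X ^ (F₁.card + F₂.card) *
          (algebraMap ℝ[X] (RatFunc ℝ) p / algebraMap ℝ[X] (RatFunc ℝ) (omega F₁ F₂ α)) ^ 2 =
        algebraMap ℝ (RatFunc ℝ)
            ((∏ f ∈ F₁, ((n : ℝ) - (f : ℝ))) * ∏ f ∈ F₂, ((n : ℝ) + (α + 1) + (f : ℝ))) *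
          algebraMap ℝ[X] (RatFunc ℝ) (laguerre n α) ^ 2 +
        weightedDeriv ratFuncDeriv (algebraMap ℝ[X] (RatFunc ℝ) X) (α + 1) b := by
  have hW : ∀ k, algebraMap ℝ[X] (RatFunc ℝ) (twistedWronskian derivative' (seed F₁ F₂ α n)
      (fun i => C (seedTwist F₁ F₂ i)) k) = _ :=
    map_twistedWronskian derivative' ratFuncDeriv _ algebraMap_derivative' _ _
  have hΩ' := algebraMap_ratFunc_ne_zero hΩ
  rw [omega_eq_twistedWronskian F₁ F₂ α n] at hΩ' ⊢
  have hlast : seed F₁ F₂ α n (F₁.card + F₂.card) = laguerre n α := by simp [seed]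
  obtain ⟨s, -, b, hb, h1, h2⟩ := isRegularAt_regularAtZero.exists_pow_mul_sq_eq
    (F₁.card + F₂.card) hα (V := 0) (Subalgebra.zero_mem _)
    (fun i => algebraMap ℝ[X] (RatFunc ℝ) (seed F₁ F₂ α n i))
    (fun i => algebraMap ℝ[X] (RatFunc ℝ) (C (seedTwist F₁ F₂ i)))
    (seedEigenvalue F₁ F₂ α n) (fun i _ => algebraMap_mem_regularAtZero _)
    (fun i _ => algebraMap_mem_regularAtZero _) (by simp [seedTwist])
    (fun i _ => laguerreOp_algebraMap (seed_ode F₁ F₂ α n i)) (by rwa [← hW])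
  rw [← hW, ← hW] at h1
  refine ⟨twistedWronskian derivative' (seed F₁ F₂ α n)
      (fun i => C (seedTwist F₁ F₂ i)) (F₁.card + F₂.card + 1), b, hb, ?_⟩
  rw [h1, mul_div_cancel_left₀ _ hΩ', h2, prod_seedEigenvalue_sub, hlast]

theorem hat_add_pos {c : ℝ} (hc : ∀ q : ℕ, c + q ≠ 0) : 0 < c + hat c := by
  refine lt_of_le_of_ne ?_ (hc _).symm
  have h1 : -⌊c⌋ ≤ (hat c : ℤ) := by
    unfold hat
    rw [Int.toNat_of_nonneg (le_max_right _ _)]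
    exact le_max_left _ _
  have h2 : -(⌊c⌋ : ℝ) ≤ hat c := by exact_mod_cast h1
  linarith [Int.floor_le c]

end ExceptionalLaguerre

/-! ### The contradiction from a negative admissibility quotient. -/

open ExceptionalLaguerre in
theorem theorem1 (F₁ F₂ : Finset ℕ) (hF₁ : ∀ f ∈ F₁, 0 < f) (hF₂ : ∀ f ∈ F₂, 0 < f)
    (α : ℝ) (hα : ∀ m : ℕ, 1 ≤ m → α ≠ -(m : ℝ))
    (hk : -1 < α + ((F₁.card + F₂.card : ℕ) : ℝ))
    (hΩ : ∀ x : ℝ, 0 ≤ x → (ExceptionalLaguerre.omega F₁ F₂ α).eval x ≠ 0) :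
    ExceptionalLaguerre.Admissible (α + 1) F₁ F₂ := by
  intro n
  by_contra hneg
  rw [not_le] at hneg
  have ha : ∀ q : ℕ, α + 1 + q ≠ 0 := by
    intro q hq
    exact hα (q + 1) (by omega) (by push_cast; linarith)
  have hΩ0 : omega F₁ F₂ α ≠ 0 := fun h0 => hΩ 0 le_rfl (by simp [h0])
  obtain ⟨p, b₁, hb₁, h1⟩ := exists_pow_mul_sq_eq_omega F₁ F₂ ha hΩ0 n
  obtain ⟨b₂, hb₂, h2⟩ := exists_pow_mul_laguerre_sq_eq n α (hat (α + 1))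
  have hreg := isRegularAt_regularAtZero
  have hΩ' := algebraMap_ratFunc_ne_zero hΩ0
  have hpos := hat_add_pos ha
  set x := algebraMap ℝ[X] (RatFunc ℝ) X with hx
  set w := omega F₁ F₂ α with hw
  set k := F₁.card + F₂.card with hkdef
  set c := hat (α + 1) with hc
  set A := (ascPochhammer ℝ c).eval ((n : ℝ) + (α + 1)) with hA
  set B := (∏ f ∈ F₁, ((n : ℝ) - (f : ℝ))) * ∏ f ∈ F₂, ((n : ℝ) + (α + 1) + (f : ℝ)) with hB
  set y := laguerre n (α + c) with hy
  -- Division by zero gives `0`, so a strictly negative quotient has nonzero denominator.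
  have hA0 : A ≠ 0 := by intro h0; simp [h0] at hneg
  obtain ⟨t, ht⟩ : ∃ t, t = -(B / A) := ⟨_, rfl⟩
  have htpos : 0 < t := by rw [ht]; linarith
  have htA : t * A = -B := by rw [ht]; field_simp
  -- `N` is the largest power of `x` visibly common to both squares. The exponent `α + 1 + N` is
  -- positive by `hk` if `N = k`, and by the choice of `ĉ` if `N = ĉ`.
  set N := min k c with hN
  have hNk : k = N + (k - N) := by omega
  have hNc : c = N + (c - N) := by omega
  have hβ : 0 < α + 1 + N := by
    rcases min_choice k c with h | h
    · rw [hN, h]; linarith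
    · rw [hN, h]; exact hpos
  -- the numerator of the right-hand side over the common denominator `w ^ 2`
  obtain ⟨q, hq⟩ : ∃ q : ℝ[X], q = X ^ (k - N) * p ^ 2 + C t * X ^ (c - N) * y ^ 2 * w ^ 2 :=
    ⟨_, rfl⟩
  have h3 : weightedDeriv ratFuncDeriv x (α + 1) (b₁ + algebraMap ℝ (RatFunc ℝ) t * b₂) =
      x ^ N * (algebraMap ℝ[X] (RatFunc ℝ) q / algebraMap ℝ[X] (RatFunc ℝ) (w ^ 2)) := by
    have h4 : algebraMap ℝ (RatFunc ℝ) t * algebraMap ℝ (RatFunc ℝ) A =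
        -algebraMap ℝ (RatFunc ℝ) B := by rw [← map_mul, htA, map_neg]
    have h5 : algebraMap ℝ[X] (RatFunc ℝ) q / algebraMap ℝ[X] (RatFunc ℝ) (w ^ 2) =
        x ^ (k - N) * (algebraMap ℝ[X] (RatFunc ℝ) p / algebraMap ℝ[X] (RatFunc ℝ) w) ^ 2 +
        algebraMap ℝ (RatFunc ℝ) t * x ^ (c - N) * algebraMap ℝ[X] (RatFunc ℝ) y ^ 2 := by
      rw [hq, algebraMap_real_ratFunc]
      simp only [map_add, map_mul, map_pow]
      field_simp
      ring
    have h6 : x ^ k = x ^ N * x ^ (k - N) := by rw [← pow_add, ← hNk]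
    have h7 : x ^ c = x ^ N * x ^ (c - N) := by rw [← pow_add, ← hNc]
    rw [h6] at h1
    rw [h7] at h2
    rw [h5, weightedDeriv_add, weightedDeriv_algebraMap_mul]
    linear_combination -h1 - algebraMap ℝ (RatFunc ℝ) t * h2 -
      algebraMap ℝ[X] (RatFunc ℝ) (laguerre n α) ^ 2 * h4
  have hg : algebraMap ℝ[X] (RatFunc ℝ) q / algebraMap ℝ[X] (RatFunc ℝ) (w ^ 2) ∈
      regularAtZero :=
    div_mem_regularAtZero _ (by rw [eval_pow]; exact pow_ne_zero 2 (hΩ 0 le_rfl))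
  obtain ⟨r, hr, hbr⟩ := hreg.exists_eq_pow_mul_of_weightedDeriv_eq ha
    (add_mem hb₁ (mul_mem (Subalgebra.algebraMap_mem _ t) hb₂)) hg h3
  rw [hbr, weightedDeriv_pow_mul _ hreg.deriv_self] at h3
  have h8 := mul_left_cancel₀ (pow_ne_zero N hreg.ne_zero) h3
  have hm0 := r.denom_ne_zero
  have h9 : w ^ 2 * (X * (derivative r.num * r.denom - r.num * derivative r.denom) +
      (C (α + 1 + N) - X) * (r.num * r.denom)) = r.denom ^ 2 * q := by
    apply RatFunc.algebraMap_injective ℝ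
    have hm' := algebraMap_ratFunc_ne_zero hm0
    rw [← r.num_div_denom, weightedDeriv, ratFuncDeriv_div _ hm0, algebraMap_real_ratFunc,
      hx] at h8
    simp only [map_add, map_mul, map_sub, map_pow] at h8 ⊢
    field_simp at h8
    linear_combination h8
  have hm : ∀ z : ℝ, 0 ≤ z → r.denom.eval z ≠ 0 := by
    intro z hz
    rcases hz.eq_or_lt with rfl | hz'
    · exact hr
    · exact eval_denom_ne_zero_of_weighted_eq r.isCoprime_num_denom hm0 h9 hz' (hΩ z hz)
  have hqe : ∀ z : ℝ, q.eval z = z ^ (k - N) * p.eval z ^ 2 +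
      t * z ^ (c - N) * y.eval z ^ 2 * w.eval z ^ 2 := by
    intro z; rw [hq]; simp
  have hy0 : ∀ z ∈ Set.Ioi (0 : ℝ), y.eval z = 0 := by
    intro z hz
    have hz' : 0 < z := hz
    have h10 := eval_eq_zero_of_weighted_eq hβ (fun v hv => hΩ v hv.le) hm h9
      (fun v hv => by rw [hqe]; positivity) hz'
    rw [hqe] at h10
    -- Both summands of `q` are nonnegative, so the vanishing of the sum kills the Laguerre term.
    have h11 : t * z ^ (c - N) * y.eval z ^ 2 * w.eval z ^ 2 = 0 := by
      have h12 : 0 ≤ z ^ (k - N) * p.eval z ^ 2 := by positivity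
      have h13 : 0 ≤ t * z ^ (c - N) * y.eval z ^ 2 * w.eval z ^ 2 := by positivity
      linarith
    have h14 := hΩ z hz'.le
    have h15 : t * z ^ (c - N) ≠ 0 := by positivity
    have h16 := (mul_eq_zero.mp h11).resolve_right (pow_ne_zero 2 h14)
    exact pow_eq_zero_iff (two_ne_zero) |>.mp ((mul_eq_zero.mp h16).resolve_left h15)
  exact laguerre_ne_zero n (α + c)
    (eq_zero_of_infinite_isRoot y ((Set.Ioi_infinite (0 : ℝ)).mono hy0))
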